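/- Let $X$ be a complex Banach space with a $1$-unconditional basis $\{e_i\}_{i\in I}$, $I$ countable (finite or infinite); that is, every $x\in X$ has a unique unconditionally convergent expansion $x=\sum_{i\in I}x_ie_i$, and $\|\sum_i\varepsilon_ix_ie_i\|=\|\sum_i x_ie_i\|$ whenever $\varepsilon_i\in\mathbb C$, $|\varepsilon_i|=1$. Write $\operatorname{supp}x=\{i\in I: x_i\ne0\}$. Suppose that $X$ is strictly monotone: $\|x+y\|>\|x\|$ for all $x,y\in X$ with nonnegative real coordinates and $y\neq0$. Let $P:X\to X$ be a bounded linear projection with $\|P\|=1$, and let $Y=P(X)$. An element $x$ of a complex Banach space $E$ is called hermitian if there is a bounded projection $Q$ of $E$ onto $\operatorname{span}\{x\}$ which is hermitian, i.e. $f(Qz)\in\mathbb R$ for all $z\in E$ and all $f\in E^*$ with $\|f\|=1$ and $f(z)=\|z\|$. The Hilbert components of $E$ are the maximal linear subspaces of the set of hermitian elements of $E$; a Hilbert component is nontrivial if its dimension is greater than $1$. Suppose that $Y$ has no nontrivial Hilbert components, and let $m=\dim Y\in\mathbb N\cup\{\infty\}$. Then there exist elements $\{y_j\}_{j=1}^m$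 of $X$ with pairwise disjoint supports and functionals $\{y_j^*\}_{j=1}^m\subset X^*$ such that $$Y=\overline{\operatorname{span}}\{y_j\},\qquad \|y_j\|=\|y_j^*\|=y_j^*(y_j)=1\ \text{ for all } j,$$ and, for all $x\in X$, $$Px=\sum_{j=1}^m y_j^*(x)\,y_j ,$$ the series converging unconditionally in norm. -/

import Mathlib

namespace OneComplemented

section Basis

open scoped ComplexOrder

variable {ι X : Type*} [NormedAddCommGroup X] [NormedSpace ℂ X]

/-- The support of `x` with respect to the basis `e`. -/
def supp (e : UnconditionalSchauderBasis ι ℂ X) (x : X) : Set ι :=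
  {i | e.coord i x ≠ 0}

/-- A (complex) unconditional basis is `1`-unconditional if the norm of `∑ i, a i • e i` does not
change when each coefficient `a i` is multiplied by a complex number `ε i` of modulus one. -/
def IsOneUnconditional (e : UnconditionalSchauderBasis ι ℂ X) : Prop :=
  ∀ (ε : ι → ℂ), (∀ i, ‖ε i‖ = 1) →
    ∀ x y : X, (∀ i, e.coord i y = ε i * e.coord i x) → ‖y‖ = ‖x‖

/-- Strict monotonicity: `‖x + y‖ > ‖x‖` for all `x, y ≥ 0` with `y ≠ 0`, the order being the
coordinatewise one. Here `0 ≤ z` for `z : ℂ` means that `z` is real and nonnegative. -/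
def IsStrictlyMonotone (e : UnconditionalSchauderBasis ι ℂ X) : Prop :=
  ∀ x y : X, (∀ i, 0 ≤ e.coord i x) → (∀ i, 0 ≤ e.coord i y) → y ≠ 0 → ‖x‖ < ‖x + y‖

end Basis

section Hermitian

variable {E : Type*} [NormedAddCommGroup E] [NormedSpace ℂ E]

/-- `f` is a norming functional for `x`. -/
def IsNorming (f : StrongDual ℂ E) (x : E) : Prop :=
  ‖f‖ = 1 ∧ f x = (‖x‖ : ℂ)

/-- A bounded operator is hermitian if its (spatial) numerical range is real. -/
def IsHermitianOp (T : E →L[ℂ] E) : Prop :=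
  ∀ (x : E) (f : StrongDual ℂ E), IsNorming f x → (f (T x)).im = 0

/-- `x` is hermitian if there is a hermitian projection from `E` onto `span {x}`. -/
def IsHermitianElt (x : E) : Prop :=
  ∃ Q : E →L[ℂ] E, IsIdempotentElem Q ∧ Q.toLinearMap.range = Submodule.span ℂ {x} ∧
    IsHermitianOp Q

/-- The Hilbert components of `E` are the maximal linear subspaces of the set of hermitian
elements of `E`. -/
def IsHilbertComponent (H : Submodule ℂ E) : Prop :=
  Maximal (fun K : Submodule ℂ E => ∀ x ∈ K, IsHermitianElt x) H

end Hermitian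

/-- `E` has no nontrivial Hilbert components, i.e. none of dimension greater than one. -/
def NoNontrivialHilbertComponents (E : Type*) [NormedAddCommGroup E] [NormedSpace ℂ E] : Prop :=
  ∀ H : Submodule ℂ E, IsHilbertComponent H → ¬ 1 < Module.rank ℂ H

/-- The dimension of a subspace, as an element of `ℕ ∪ {∞}`. -/
noncomputable def dim {X : Type*} [AddCommGroup X] [Module ℂ X] (Y : Submodule ℂ X) : ℕ∞ :=
  Cardinal.toENat (Module.rank ℂ Y)

end OneComplemented

/-!
The coordinate projections of a `1`-unconditional basis `e` are hermitian, because they generate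
isometries. If `P` is a contractive projection onto `Y`, a norming functional on `Y` extends through
`P` to a norming functional on `X`, so the compressions `y ↦ coord i y • P (e i)` are hermitian
operators of rank at most one on `Y` (`IsOneUnconditional.isHermitianOp_compression`). A hermitian
operator of square zero vanishes, so a nonzero compression is a real multiple of a hermitian
projection onto the line spanned by `P (e i)`.

Two rank-one hermitian projections onto distinct lines either annihilate each other, or every vector
in the plane spanned by the two lines is hermitian (`isHermitianElt_of_mem_span_pair`). In the second
case, conjugating one projection by the isometries generated by the other one gives the hermitian
operators that couple the two lines, and real combinations of these with the projections
include one of rank one onto any prescribed line of the plane. When `Y` has no nontrivial Hilbert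
component, the second case is impossible. Thus the index set of the nonzero compressions splits
according to the lines spanned by the `P (e i)`, and `coord i (P (e j)) = 0` for `i`, `j` in distinct
classes.

Strict monotonicity rules out the remaining overlap: an element `y` of `Y` vanishes at each `i` with
`P (e i) = 0`, since removing those coordinates would lower the norm but not change the image under
`P` (`IsOneUnconditional.map_basis_ne_zero`). Hence normalized representatives `y c` of the lines have
disjoint supports. The component of `P x` on the class `c` is a multiple of `y c`, and its
coefficient defines the functional `y' c`; band projections being contractive, this functional has
norm one, and grouping the basis expansion of `P x` by classes gives the unconditional expansion.
-/

namespace OneComplemented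

open scoped ComplexConjugate

/-! ### Hermitian operators -/

section Hermitian

variable {E : Type*} [NormedAddCommGroup E] [NormedSpace ℂ E] {S T : E →L[ℂ] E}

theorem IsHermitianOp.im_eq_zero (hT : IsHermitianOp T) {f : StrongDual ℂ E} {x : E}
    (hf : ∀ y, ‖f y‖ ≤ ‖y‖) (hx : f x = (‖x‖ : ℂ)) : (f (T x)).im = 0 := by
  rcases eq_or_ne x 0 with rfl | h0
  · simp
  refine hT x f ⟨le_antisymm (f.opNorm_le_bound zero_le_one fun y => by simpa using hf y) ?_, hx⟩
  have h := f.le_opNorm x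
  rw [hx, Complex.norm_real, norm_norm] at h
  exact le_of_mul_le_mul_right (by simpa using h) (norm_pos_iff.2 h0)

theorem isHermitianOp_zero : IsHermitianOp (0 : E →L[ℂ] E) := fun x f _ => by simp

theorem IsHermitianOp.add (hS : IsHermitianOp S) (hT : IsHermitianOp T) :
    IsHermitianOp (S + T) := fun x f h => by
  simp [hS x f h, hT x f h]

theorem IsHermitianOp.real_smul (hT : IsHermitianOp T) (r : ℝ) :
    IsHermitianOp ((r : ℂ) • T) := fun x f h => by
  simp [hT x f h]

theorem IsHermitianOp.sub (hS : IsHermitianOp S) (hT : IsHermitianOp T) :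
    IsHermitianOp (S - T) := by
  have h := hS.add (hT.real_smul (-1))
  rwa [show S + ((-1 : ℝ) : ℂ) • T = S - T by simp [sub_eq_add_neg]] at h

theorem exists_isNorming {x : E} (hx : x ≠ 0) : ∃ f : StrongDual ℂ E, IsNorming f x :=
  exists_dual_vector ℂ x (norm_ne_zero_iff.2 hx)

theorem IsHermitianOp.im_eigenvalue (hT : IsHermitianOp T) {x : E} (hx : x ≠ 0) {μ : ℂ}
    (h : T x = μ • x) : μ.im = 0 := by
  obtain ⟨f, hf⟩ := exists_isNorming hx
  have := hT x f hf
  rw [h, map_smul, hf.2] at this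
  simpa [hx] using this

/-- A hermitian operator is dissipative in both imaginary directions. -/
theorem IsHermitianOp.norm_le_norm_add (hT : IsHermitianOp T) (s : ℝ) (x : E) :
    ‖x‖ ≤ ‖x + (s * Complex.I) • T x‖ := by
  rcases eq_or_ne x 0 with rfl | hx
  · simp
  obtain ⟨f, hf⟩ := exists_isNorming hx
  have h0 := hT x f hf
  have h1 : (f (x + (s * Complex.I) • T x)).re = ‖x‖ := by
    simp [hf.2, h0]
  calc ‖x‖ = (f (x + (s * Complex.I) • T x)).re := h1.symm
    _ ≤ ‖f (x + (s * Complex.I) • T x)‖ := Complex.re_le_norm _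
    _ ≤ ‖f‖ * ‖x + (s * Complex.I) • T x‖ := f.le_opNorm _
    _ = _ := by rw [hf.1, one_mul]

theorem IsHermitianOp.eq_zero_of_sq_eq_zero (hT : IsHermitianOp T) (h : ∀ x, T (T x) = 0) :
    T = 0 := by
  ext x
  -- `1 - i s T` is the inverse of `1 + i s T`, hence contractive for every real `s`.
  have key : ∀ s : ℝ, ‖x - (s * Complex.I) • T x‖ ≤ ‖x‖ := fun s => by
    simpa [h] using hT.norm_le_norm_add s (x - (s * Complex.I) • T x)
  by_contra hx
  have hpos : 0 < ‖T x‖ := norm_pos_iff.2 hx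
  have h1 := key ((2 * ‖x‖ + 1) / ‖T x‖)
  have h2 := norm_sub_norm_le ((((2 * ‖x‖ + 1) / ‖T x‖ : ℝ) * Complex.I) • T x) x
  rw [norm_sub_rev, norm_smul, norm_mul, Complex.norm_real, Complex.norm_I, mul_one,
    Real.norm_of_nonneg (by positivity), div_mul_cancel₀ _ hpos.ne'] at h2
  linarith

/-- If `T` is a hermitian projection then `exp (i t T) = 1 + (e ^ (i t) - 1) T` is contractive,
being the limit of the contractions `(1 - i t T / n) ^ (-n)`. -/
theorem IsHermitianOp.norm_add_le (hT : IsHermitianOp T) (hi : ∀ x, T (T x) = T x) {z : ℂ}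
    (hz : ‖z‖ = 1) (x : E) : ‖x + (z - 1) • T x‖ ≤ ‖x‖ := by
  have step : ∀ (s : ℝ) (x : E), ‖x + ((1 + s * Complex.I)⁻¹ - 1) • T x‖ ≤ ‖x‖ := by
    intro s x
    have hne : (1 + s * Complex.I) ≠ 0 := fun h => by simpa using congrArg Complex.re h
    have h := hT.norm_le_norm_add s (x + ((1 + s * Complex.I)⁻¹ - 1) • T x)
    have e : x + ((1 + s * Complex.I)⁻¹ - 1) • T x +
        (s * Complex.I) • T (x + ((1 + s * Complex.I)⁻¹ - 1) • T x) = x := by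
      have : ((1 + s * Complex.I)⁻¹ - 1) + (s * Complex.I) +
          (s * Complex.I) * ((1 + s * Complex.I)⁻¹ - 1) = 0 := by field_simp; ring
      rw [map_add, map_smul, hi]
      linear_combination (norm := module) this • T x
    rwa [e] at h
  have pow : ∀ (s : ℝ) (n : ℕ), ‖x + (((1 + s * Complex.I) ^ n)⁻¹ - 1) • T x‖ ≤ ‖x‖ := by
    intro s n
    induction n with
    | zero => simp
    | succ n ih =>
      refine le_trans (le_of_eq ?_) ((step s _).trans ih)
      congr 1
      rw [map_add, map_smul, hi, pow_succ, mul_inv]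
      module
  obtain ⟨θ, rfl⟩ : ∃ θ : ℝ, z = Complex.exp (θ * Complex.I) :=
    ⟨z.arg, by simpa [hz] using (Complex.norm_mul_exp_arg_mul_I z).symm⟩
  have lim : Filter.Tendsto (fun n : ℕ => ((1 + (-θ * Complex.I) / n) ^ n)⁻¹) Filter.atTop
      (nhds (Complex.exp (θ * Complex.I))) := by
    have := (Complex.tendsto_one_add_div_pow_exp (-θ * Complex.I)).inv₀ (Complex.exp_ne_zero _)
    rwa [← Complex.exp_neg, neg_mul, neg_neg, ← neg_mul] at this
  refine le_of_tendsto (((lim.sub_const 1).smul_const (T x)).const_add x).norm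
    (Filter.Eventually.of_forall fun n => ?_)
  have := pow (-θ / n) n
  push_cast at this
  rwa [div_mul_eq_mul_div] at this

theorem IsHermitianOp.norm_add_eq (hT : IsHermitianOp T) (hi : ∀ x, T (T x) = T x) {z : ℂ}
    (hz : ‖z‖ = 1) (x : E) : ‖x + (z - 1) • T x‖ = ‖x‖ := by
  refine le_antisymm (hT.norm_add_le hi hz x) ?_
  have hz0 : z ≠ 0 := fun h => by simp [h] at hz
  have h := hT.norm_add_le hi (z := z⁻¹) (by simp [hz]) (x + (z - 1) • T x)
  have e : x + (z - 1) • T x + (z⁻¹ - 1) • T (x + (z - 1) • T x) = x := by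
    have : (z - 1) + (z⁻¹ - 1) + (z⁻¹ - 1) * (z - 1) = 0 := by field_simp; ring
    rw [map_add, map_smul, hi]
    linear_combination (norm := module) this • T x
  rwa [e] at h

/-- Conjugation by a surjective isometry preserves hermitian operators. -/
theorem IsHermitianOp.conj (hS : IsHermitianOp S) {V W : E →L[ℂ] E} (hV : ∀ x, ‖V x‖ = ‖x‖)
    (hVW : ∀ x, V (W x) = x) : IsHermitianOp (V ∘L S ∘L W) := fun x f hf => by
  refine hS.im_eq_zero (f := f ∘L V) (x := W x) (fun y => ?_) ?_
  · simpa [hf.1, hV] using f.le_opNorm (V y)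
  · simp [hVW, hf.2, ← hV (W x)]

end Hermitian

/-! ### Hermitian elements and Hilbert components -/

section HilbertComponent

variable {E : Type*} [NormedAddCommGroup E] [NormedSpace ℂ E]

theorem isHermitianElt_zero : IsHermitianElt (0 : E) :=
  ⟨0, IsIdempotentElem.zero, by simp [LinearMap.range_zero], isHermitianOp_zero⟩

/-- A hermitian rank-one operator with nonzero trace is a real multiple of a projection. -/
theorem isHermitianElt_of_smulRight {f : StrongDual ℂ E} {u : E} (hfu : f u ≠ 0)
    (h : IsHermitianOp (f.smulRight u)) : IsHermitianElt u := by
  have hu : u ≠ 0 := fun h0 => hfu (by simp [h0])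
  have him : (f u).im = 0 := h.im_eigenvalue hu (by simp)
  obtain ⟨r, hr⟩ : ∃ r : ℝ, f u = r := ⟨(f u).re, Complex.ext (by simp) (by simp [him])⟩
  have hr0 : (r : ℂ) ≠ 0 := hr ▸ hfu
  refine ⟨((r⁻¹ : ℝ) : ℂ) • f.smulRight u, ?_, ?_, h.real_smul _⟩
  · ext x
    simp [hr, smul_comm (f x), inv_smul_smul₀ hr0, -Complex.coe_smul]
  · apply le_antisymm
    · rintro _ ⟨x, rfl⟩
      exact Submodule.mem_span_singleton.2 ⟨(r : ℂ)⁻¹ * f x, by simp [smul_smul]⟩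
    · rw [Submodule.span_singleton_le_iff_mem]
      exact ⟨u, by simp [hr, inv_smul_smul₀ hr0, -Complex.coe_smul]⟩

theorem IsHermitianOp.eq_zero_or_of_smulRight {f : StrongDual ℂ E} {u : E}
    (h : IsHermitianOp (f.smulRight u)) (hfu : f u = 0) : f = 0 ∨ u = 0 := by
  have h0 := h.eq_zero_of_sq_eq_zero (fun x => by simp [hfu])
  refine or_iff_not_imp_right.2 fun hu => ContinuousLinearMap.ext fun x => ?_
  simpa [hu] using DFunLike.congr_fun h0 x

section TwoProjections

variable {f g : StrongDual ℂ E} {u v : E}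

/-- The eigenvalues of the sum of two rank-one projections are `1 ± √(f v * g u)` on
the plane of the two lines, so `f v * g u` is the square of a real number. -/
theorem exists_real_apply_mul_apply (hf : IsHermitianOp (f.smulRight u)) (hfu : f u = 1)
    (hg : IsHermitianOp (g.smulRight v)) (hgv : g v = 1) (huv : LinearIndependent ℂ ![u, v])
    (ha : f v ≠ 0) : ∃ r : ℝ, f v * g u = r := by
  obtain ⟨s, hs⟩ := IsAlgClosed.exists_pow_nat_eq (f v * g u) (n := 2) (by norm_num)
  have hx : f v • u + s • v ≠ 0 := fun h =>
    ha (LinearIndependent.pair_iff.1 huv _ _ h).1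
  have him : (1 + s).im = 0 := by
    refine (hf.add hg).im_eigenvalue hx ?_
    simp only [_root_.add_apply, ContinuousLinearMap.smulRight_apply, map_add,
      map_smul, hfu, hgv]
    linear_combination (norm := module) hs.symm • v
  refine ⟨s.re ^ 2, ?_⟩
  have : s = (s.re : ℂ) := Complex.ext (by simp) (by simpa using him)
  rw [← hs]; push_cast; rw [← this]

/-- Conjugating the projection onto `v` by the isometries `1 + (z - 1) T`, where `T` is the
projection onto `u` and `|z| = 1`, yields the hermitian operators that couple `u` and `v`. -/
theorem isHermitianOp_coupling (hf : IsHermitianOp (f.smulRight u)) (hfu : f u = 1)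
    (hg : IsHermitianOp (g.smulRight v)) {r : ℝ} (hr : f v * g u = r) (c : ℂ) :
    IsHermitianOp ((c * f v) • g.smulRight u + (conj c * g u) • f.smulRight v) := by
  have unit : ∀ z : ℂ, ‖z‖ = 1 → IsHermitianOp
      (((z - 1) * f v) • g.smulRight u + (conj (z - 1) * g u) • f.smulRight v) := by
    intro z hz
    have hzz : z * conj z = 1 := by rw [Complex.mul_conj, Complex.normSq_eq_norm_sq, hz]; simp
    let A : ℂ → E →L[ℂ] E := fun w => ContinuousLinearMap.id ℂ E + (w - 1) • f.smulRight u
    have h := (hg.conj (V := A z) (W := A (conj z))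
      (fun x => by
        simpa [A] using hf.norm_add_eq (fun x => by simp [hfu]) hz x)
      (fun x => by
        simp only [A, _root_.add_apply, ContinuousLinearMap.coe_id', id_eq,
          _root_.smul_apply, ContinuousLinearMap.smulRight_apply, map_add, map_smul,
          hfu]
        have : (conj z - 1) + (z - 1) + (z - 1) * (conj z - 1) = 0 := by
          linear_combination hzz
        linear_combination (norm := module) (this * f x) • u)).sub
          (hg.add (hf.real_smul (Complex.normSq (z - 1) * r)))
    convert h using 1
    ext x
    simp only [A, _root_.add_apply, ContinuousLinearMap.coe_id', id_eq,
      _root_.smul_apply, ContinuousLinearMap.smulRight_apply, map_add, map_smul,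
      ContinuousLinearMap.comp_apply, _root_.sub_apply,
      Complex.ofReal_mul, ← Complex.mul_conj, ← hr, map_sub, map_one]
    module
  -- The numbers `z - 1` with `z = -1` and `z = i` form a real basis of the complex plane.
  have h := ((unit (-1) (by simp)).real_smul (-(c.re + c.im) / 2)).add
    ((unit Complex.I (by simp)).real_smul c.im)
  convert h using 1
  obtain ⟨p, q⟩ := c
  ext x
  simp only [_root_.add_apply, _root_.smul_apply,
    ContinuousLinearMap.smulRight_apply, map_sub, map_one, map_neg, Complex.conj_I,
    show (⟨p, q⟩ : ℂ) = p + q * Complex.I from Complex.mk_eq_add_mul_I p q, map_add, map_mul,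
    Complex.conj_ofReal]
  push_cast
  module

/-- If two hermitian projections of rank one onto distinct lines do not annihilate each other, then
every vector in the span of the two lines is hermitian. -/
theorem isHermitianElt_of_mem_span_pair (hf : IsHermitianOp (f.smulRight u)) (hfu : f u = 1)
    (hg : IsHermitianOp (g.smulRight v)) (hgv : g v = 1) (huv : LinearIndependent ℂ ![u, v])
    (ha : f v ≠ 0) {w : E} (hw : w ∈ Submodule.span ℂ {u, v}) : IsHermitianElt w := by
  obtain ⟨r, hr⟩ := exists_real_apply_mul_apply hf hfu hg hgv huv ha
  have hu : u ≠ 0 := huv.ne_zero 0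
  have hg0 : g ≠ 0 := fun h => by simp [h] at hgv
  -- If `g u = 0`, the coupling operator would be a nonzero nilpotent hermitian operator.
  have hb : g u ≠ 0 := by
    intro hb
    have h := isHermitianOp_coupling hf hfu hg hr 1
    rw [hb, mul_zero, zero_smul, add_zero, one_mul] at h
    rw [show f v • g.smulRight u = g.smulRight (f v • u) by
      ext
      simp only [_root_.smul_apply, ContinuousLinearMap.smulRight_apply, smul_comm (f v)]] at h
    rcases h.eq_zero_or_of_smulRight (by simp [hb]) with h | h
    · exact hg0 h
    · exact (smul_ne_zero ha hu) h
  obtain ⟨α, β, rfl⟩ := Submodule.mem_span_pair.1 hw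
  by_cases hw0 : α • u + β • v = 0
  · rw [hw0]; exact isHermitianElt_zero
  -- The functional of the rank-one operator is chosen so that the coefficients of the two
  -- projections are real and the coupling terms are conjugate.
  set h : StrongDual ℂ E := (f v * g u * conj α) • f + (f v * conj (f v) * conj β) • g with hh
  have hH : IsHermitianOp (h.smulRight (α • u + β • v)) := by
    have := ((hf.real_smul (Complex.normSq α * r)).add
      (hg.real_smul (Complex.normSq (f v) * Complex.normSq β))).add
      (isHermitianOp_coupling hf hfu hg hr (conj (f v) * α * conj β))
    convert this using 1
    ext x
    simp only [hh, _root_.add_apply, _root_.smul_apply,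
      ContinuousLinearMap.smulRight_apply, map_mul, Complex.conj_conj, Complex.ofReal_mul, ← hr,
      ← Complex.mul_conj, smul_eq_mul]
    module
  -- Vanishing trace makes the operator nilpotent, so `h = 0` and `f`, `g` are proportional.
  refine isHermitianElt_of_smulRight (fun h0 => ?_) hH
  have hz : h = 0 := (hH.eq_zero_or_of_smulRight h0).resolve_right hw0
  have ha' : conj (f v) ≠ 0 := by simpa using ha
  have h1 : conj α + conj (f v) * conj β = 0 := by
    have : f v * g u * (conj α + conj (f v) * conj β) = 0 := by
      have := DFunLike.congr_fun hz u
      simp [hh, hfu] at this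
      linear_combination this
    simpa [ha, hb] using this
  have hβ : conj β ≠ 0 := fun h0 => by
    have hα : α = 0 := by simpa [h0] using h1
    have hβ : β = 0 := by simpa using h0
    exact hw0 (by simp [hα, hβ])
  have h2 : f = f v • g := by
    ext x
    have := DFunLike.congr_fun hz x
    simp only [hh, _root_.add_apply, _root_.smul_apply, smul_eq_mul,
      _root_.zero_apply] at this
    have hk : ∀ k : ℂ, k = f v * g u → k = 1 := by
      rintro k rfl
      have h3 := DFunLike.congr_fun hz v
      simp only [hh, _root_.add_apply, _root_.smul_apply, smul_eq_mul,
        _root_.zero_apply, hgv] at h3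
      have : f v * conj (f v) * conj β * (f v * g u - 1) = 0 := by
        linear_combination -h3 + f v * g u * f v * h1
      simpa [ha, ha', hβ, sub_eq_zero] using this
    have hk1 := hk _ rfl
    have : conj (f v) * conj β * (f x - f v * g x) = 0 := by
      rw [hk1] at this
      linear_combination -this + f x * h1
    simpa [ha', hβ, sub_eq_zero] using this
  have hab : f v * g u = 1 := by
    have := DFunLike.congr_fun h2 u
    simpa [hfu, eq_comm] using this
  -- The two projections now share a kernel, so their difference squares to zero.
  have h3 := hf.sub hg
  rw [show f.smulRight u - g.smulRight v = g.smulRight (f v • u - v) by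
    ext x
    have := DFunLike.congr_fun h2 x
    simp only [_root_.smul_apply, smul_eq_mul] at this
    simp only [_root_.sub_apply, ContinuousLinearMap.smulRight_apply]
    rw [this]; module] at h3
  rcases h3.eq_zero_or_of_smulRight (by simp [hab, hgv]) with h | h
  · exact hg0 h
  · have := (LinearIndependent.pair_iff.1 huv (f v) (-1) (by rw [← h]; module)).2
    norm_num at this

end TwoProjections

/-- By Zorn's lemma, every subspace of hermitian elements lies in a Hilbert component. -/
theorem exists_isHilbertComponent_ge {K : Submodule ℂ E} (hK : ∀ x ∈ K, IsHermitianElt x) :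
    ∃ H, K ≤ H ∧ IsHilbertComponent H := by
  refine zorn_le_nonempty₀ {K : Submodule ℂ E | ∀ x ∈ K, IsHermitianElt x}
    (fun c hc hchain M hM => ⟨sSup c, fun x hx => ?_, fun _ => le_sSup⟩) K hK
  obtain ⟨N, hN, hxN⟩ := (Submodule.mem_sSup_of_directed ⟨M, hM⟩ hchain.directedOn).1 hx
  exact hc hN x hxN

/-- Without nontrivial Hilbert components, rank-one hermitian projections onto distinct lines
annihilate each other. -/
theorem NoNontrivialHilbertComponents.apply_eq_zero (hE : NoNontrivialHilbertComponents E)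
    {f g : StrongDual ℂ E} {u v : E} (hf : IsHermitianOp (f.smulRight u)) (hfu : f u ≠ 0)
    (hg : IsHermitianOp (g.smulRight v)) (hgv : g v ≠ 0) (huv : LinearIndependent ℂ ![u, v]) :
    f v = 0 := by
  by_contra ha
  -- Rescale the vectors so that the rank-one operators become projections.
  have normalize : ∀ {f : StrongDual ℂ E} {u : E}, IsHermitianOp (f.smulRight u) → f u ≠ 0 →
      IsHermitianOp (((f u)⁻¹ • f).smulRight u) := by
    intro f u h hfu
    have hu : u ≠ 0 := fun h0 => hfu (by simp [h0])
    have him : (f u).im = 0 := h.im_eigenvalue hu (by simp)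
    obtain ⟨r, hr⟩ : ∃ r : ℝ, f u = r := ⟨(f u).re, Complex.ext (by simp) (by simp [him])⟩
    have := h.real_smul r⁻¹
    convert this using 1
    ext x
    simp [hr, smul_smul]
  obtain ⟨H, hle, hH⟩ := exists_isHilbertComponent_ge (K := Submodule.span ℂ {u, v})
    fun w hw => isHermitianElt_of_mem_span_pair (normalize hf hfu) (by simp [hfu])
      (normalize hg hgv) (by simp [hgv]) huv (by simp [hfu, ha]) hw
  refine hE H hH ?_
  have h2 : Module.rank ℂ (Submodule.span ℂ (Set.range ![u, v])) = 2 := by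
    rw [rank_span huv]; simpa using Cardinal.mk_range_eq_of_injective huv.injective
  rw [Matrix.range_cons_cons_empty] at h2
  exact lt_of_lt_of_le (by rw [h2]; exact Cardinal.one_lt_two) (Submodule.rank_mono hle)

end HilbertComponent

/-! ### Spaces with a `1`-unconditional basis -/

section UnconditionalBasis

variable {ι X : Type*} [NormedAddCommGroup X] [NormedSpace ℂ X]
  (e : UnconditionalSchauderBasis ι ℂ X)

theorem ext_coord {x y : X} (h : ∀ i, e.coord i x = e.coord i y) : x = y :=
  (e.expansion x).unique (by simpa only [h] using e.expansion y)

theorem coord_eq_of_hasSum {c : ι → ℂ} {y : X} (h : HasSum (fun i => c i • e i) y) (i : ι) :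
    e.coord i y = c i := by
  classical
  have h1 := h.mapL (e.coord i)
  simp only [map_smul, e.ortho, smul_eq_mul] at h1
  have h2 : (fun j => c j * (Pi.single j 1 : ι → ℂ) i) = fun j => if j = i then c i else 0 := by
    funext j
    rcases eq_or_ne j i with rfl | hj
    · simp
    · simp [hj, hj.symm]
  rw [h2] at h1
  exact h1.unique (hasSum_ite_eq i (c i))

variable {e} (he : IsOneUnconditional e)
include he

theorem IsOneUnconditional.norm_add_smul (i : ι) {z : ℂ} (hz : ‖z‖ = 1) (x : X) :
    ‖x + ((z - 1) * e.coord i x) • e i‖ = ‖x‖ := by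
  classical
  refine he (Function.update 1 i z) (fun j => ?_) _ _ (fun j => ?_)
  · rcases eq_or_ne j i with rfl | hj <;> simp [*]
  · rcases eq_or_ne j i with rfl | hj
    · simp [e.ortho]; ring
    · simp [e.ortho, hj]

/-- The rank-one coordinate projections of a `1`-unconditional basis are hermitian. -/
theorem IsOneUnconditional.im_coord_mul_eq_zero {f : StrongDual ℂ X} {x : X}
    (hf : ∀ y, ‖f y‖ ≤ ‖y‖) (hx : f x = (‖x‖ : ℂ)) (i : ι) :
    (e.coord i x * f (e i)).im = 0 := by
  set c := e.coord i x * f (e i) with hc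
  have h1 : ∀ z : ℂ, ‖z‖ = 1 → ((z - 1) * c).re ≤ 0 := by
    intro z hz
    have h := (Complex.re_le_norm _).trans ((hf _).trans_eq (he.norm_add_smul i hz x))
    rw [map_add, map_smul, hx, smul_eq_mul, mul_assoc, ← hc, Complex.add_re,
      Complex.ofReal_re] at h
    linarith
  -- Parametrize the unit circle rationally by the Cayley transform.
  have h2 : ∀ t : ℝ, 0 ≤ t * (c.im + t * c.re) := by
    intro t
    have hpos : 0 < 1 + t ^ 2 := by positivity
    have hne : ((1 + t ^ 2 : ℝ) : ℂ) ≠ 0 := by exact_mod_cast hpos.ne'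
    have hz : ‖((1 + t * Complex.I) ^ 2 / ((1 + t ^ 2 : ℝ) : ℂ) : ℂ)‖ = 1 := by
      have hn : ‖(1 + t * Complex.I : ℂ)‖ ^ 2 = 1 + t ^ 2 := by
        rw [← Complex.normSq_eq_norm_sq]; simp [Complex.normSq_apply]; ring
      rw [norm_div, norm_pow, hn, Complex.norm_real, Real.norm_of_nonneg hpos.le,
        div_self hpos.ne']
    have h := h1 _ hz
    have e1 : ((1 + t * Complex.I) ^ 2 / ((1 + t ^ 2 : ℝ) : ℂ) - 1) * c
        = ((2 * t / (1 + t ^ 2) : ℝ) : ℂ) * ((Complex.I - t) * c) := by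
      push_cast at hne ⊢
      field_simp
      linear_combination (c * t ^ 2) * Complex.I_sq
    rw [e1, Complex.re_ofReal_mul] at h
    have e2 : ((Complex.I - t) * c).re = -(c.im + t * c.re) := by simp; ring
    rw [e2, div_mul_eq_mul_div, div_le_iff₀ hpos] at h
    linarith
  by_contra hq
  have hk : 0 < 1 + |c.re| := by positivity
  have h3 := h2 (-c.im / (1 + |c.re|))
  have e3 : -c.im / (1 + |c.re|) * (c.im + -c.im / (1 + |c.re|) * c.re)
      = -(c.im / (1 + |c.re|)) ^ 2 * (1 + |c.re| - c.re) := by field_simp; ring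
  rw [e3] at h3
  have h4 : 0 < (c.im / (1 + |c.re|)) ^ 2 := by positivity
  nlinarith [le_abs_self c.re]

variable [CompleteSpace X]

/-- Unimodular multipliers act on a space with a `1`-unconditional basis. -/
theorem IsOneUnconditional.exists_coord_eq_mul {ε : ι → ℂ} (hε : ∀ i, ‖ε i‖ = 1) (x : X) :
    ∃ y, ‖y‖ = ‖x‖ ∧ ∀ i, e.coord i y = ε i * e.coord i x := by
  classical
  have hs : Summable fun i => (ε i * e.coord i x) • e i := by
    rw [summable_iff_vanishing_norm]
    intro δ hδ
    obtain ⟨s, hs⟩ := summable_iff_vanishing_norm.1 (e.expansion x).summable δ hδ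
    refine ⟨s, fun t ht => ?_⟩
    rw [he ε hε (∑ i ∈ t, e.coord i x • e i)]
    · exact hs t ht
    · intro i
      simp [e.ortho, Pi.single_apply]
  have h := coord_eq_of_hasSum e hs.hasSum
  exact ⟨_, he ε hε x _ h, h⟩

/-- The band projections of a space with a `1`-unconditional basis are contractive. -/
theorem IsOneUnconditional.exists_coord_eq_indicator (s : Set ι) (x : X) :
    ∃ y, ‖y‖ ≤ ‖x‖ ∧ ∀ i, e.coord i y = s.indicator (fun i => e.coord i x) i := by
  classical
  obtain ⟨x', hn, hx'⟩ := he.exists_coord_eq_mul (ε := fun i => if i ∈ s then 1 else -1)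
    (fun i => by split_ifs <;> simp) x
  refine ⟨(2⁻¹ : ℂ) • (x + x'), ?_, fun i => ?_⟩
  · rw [norm_smul]
    have := norm_add_le x x'
    norm_num
    linarith
  · by_cases hi : i ∈ s <;> simp [hx', hi]
    ring

end UnconditionalBasis

/-! ### Contractive projections -/

section ContractiveProjection

variable {ι X : Type*} [NormedAddCommGroup X] [NormedSpace ℂ X]
  {e : UnconditionalSchauderBasis ι ℂ X} {P : X →L[ℂ] X}

theorem hasSum_coord_smul_map (e : UnconditionalSchauderBasis ι ℂ X) (P : X →L[ℂ] X) (x : X) :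
    HasSum (fun i => e.coord i x • P (e i)) (P x) := by
  simpa using (e.expansion x).mapL P

theorem apply_eq_self_of_mem_range (hP : IsIdempotentElem P) {y : X}
    (hy : y ∈ P.toLinearMap.range) : P y = y := by
  obtain ⟨x, rfl⟩ := hy
  exact DFunLike.congr_fun hP x

/-- The compression of a coordinate projection to the range of a contractive projection is
hermitian, because norming functionals of the range extend through `P` to norming functionals of
the whole space. -/
theorem IsOneUnconditional.isHermitianOp_compression (he : IsOneUnconditional e)
    (hP : IsIdempotentElem P) (hP1 : ‖P‖ = 1) (i : ι) :
    IsHermitianOp (((e.coord i).comp P.toLinearMap.range.subtypeL).smulRight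
      (⟨P (e i), ⟨e i, rfl⟩⟩ : P.toLinearMap.range)) := by
  intro y φ hφ
  let R : X →L[ℂ] P.toLinearMap.range := P.codRestrict _ (fun x => ⟨x, rfl⟩)
  have h := he.im_coord_mul_eq_zero (f := φ ∘L R) (x := y) (fun x => ?_) ?_ i
  · simpa [R] using! h
  · calc ‖φ (R x)‖ ≤ ‖φ‖ * ‖R x‖ := φ.le_opNorm _
      _ = ‖P x‖ := by rw [hφ.1, one_mul]; rfl
      _ ≤ ‖P‖ * ‖x‖ := P.le_opNorm x
      _ = ‖x‖ := by rw [hP1, one_mul]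
  · have : R y = y := Subtype.ext (apply_eq_self_of_mem_range hP y.2)
    rw [ContinuousLinearMap.comp_apply, this, hφ.2]
    rfl

/-- Strict monotonicity forces elements of the range to vanish at every basis vector killed by the
projection: otherwise deleting these coordinates would decrease the norm strictly without changing
the image under `P`. -/
theorem IsOneUnconditional.map_basis_ne_zero [CompleteSpace X] (he : IsOneUnconditional e)
    (hmono : IsStrictlyMonotone e) (hP : IsIdempotentElem P) (hP1 : ‖P‖ = 1) {y : X}
    (hy : y ∈ P.toLinearMap.range) {j : ι} (hj : e.coord j y ≠ 0) : P (e j) ≠ 0 := by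
  intro hPj
  obtain ⟨r, -, hr⟩ := he.exists_coord_eq_indicator {i | P (e i) ≠ 0} y
  have hPr : P r = y := by
    rw [← apply_eq_self_of_mem_range hP hy]
    refine (hasSum_coord_smul_map e P r).unique ?_
    convert hasSum_coord_smul_map e P y using 2 with i
    by_cases hi : P (e i) = 0 <;> simp [hr, hi]
  have hε : ∀ c : ℂ, ∃ ε : ℂ, ‖ε‖ = 1 ∧ ε * c = ‖c‖ := fun c => by
    rcases eq_or_ne c 0 with rfl | hc
    · exact ⟨1, by simp⟩
    · have hc' : (‖c‖ : ℂ) ≠ 0 := by simpa using hc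
      refine ⟨‖c‖ / c, ?_, div_mul_cancel₀ _ hc⟩
      rw [norm_div, Complex.norm_real, norm_norm, div_self (by simpa using hc)]
  choose ε hε1 hε2 using fun i => hε (e.coord i y)
  obtain ⟨a, ha, hac⟩ := he.exists_coord_eq_mul hε1 r
  obtain ⟨b, -, hbc⟩ := he.exists_coord_eq_mul hε1 (y - r)
  have hab : ‖a + b‖ = ‖y‖ := he ε hε1 _ _ fun i => by rw [map_add, hac, hbc, map_sub]; ring
  have hlt : ‖a‖ < ‖a + b‖ := by
    refine hmono a b (fun i => ?_) (fun i => ?_) (fun hb => ?_)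
    · by_cases hi : P (e i) = 0 <;> simp [hac, hr, hi, hε2]
    · by_cases hi : P (e i) = 0 <;> simp [hbc, hr, hi, hε2]
    · have := hbc j
      rw [hb, map_zero, map_sub, hr] at this
      simp [hPj, hε2] at this
      exact hj (norm_eq_zero.1 (by exact_mod_cast this.symm))
  have hle : ‖P r‖ ≤ ‖r‖ := by simpa [hP1] using P.le_opNorm r
  rw [ha, hab, ← hPr, hPr] at hlt
  rw [hPr] at hle
  exact absurd hle (not_le.2 hlt)

/-- The set of basis indices at which some element of the range of `P` does not vanish. -/
def rangeSupp (e : UnconditionalSchauderBasis ι ℂ X) (P : X →L[ℂ] X) : Set ι :=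
  {i | ∃ y ∈ P.toLinearMap.range, e.coord i y ≠ 0}

/-- The line spanned by the image of the `i`-th basis vector. -/
def imageLine (e : UnconditionalSchauderBasis ι ℂ X) (P : X →L[ℂ] X)
    (i : rangeSupp e P) : Submodule ℂ X :=
  Submodule.span ℂ {P (e i)}

variable [CompleteSpace X]

theorem IsOneUnconditional.coord_map_basis_self_ne_zero (he : IsOneUnconditional e)
    (hmono : IsStrictlyMonotone e) (hP : IsIdempotentElem P) (hP1 : ‖P‖ = 1) {i : ι}
    (hi : i ∈ rangeSupp e P) : e.coord i (P (e i)) ≠ 0 := by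
  intro h
  obtain ⟨y, hy, hiy⟩ := hi
  rcases (he.isHermitianOp_compression hP hP1 i).eq_zero_or_of_smulRight h with h | h
  · exact hiy (DFunLike.congr_fun h ⟨y, hy⟩)
  · exact he.map_basis_ne_zero hmono hP hP1 hy hiy (congrArg Subtype.val h)

theorem IsOneUnconditional.coord_map_basis_eq_zero (he : IsOneUnconditional e)
    (hmono : IsStrictlyMonotone e) (hP : IsIdempotentElem P) (hP1 : ‖P‖ = 1)
    (hY : NoNontrivialHilbertComponents P.toLinearMap.range) {i j : rangeSupp e P}
    (hij : imageLine e P i ≠ imageLine e P j) : e.coord i (P (e j)) = 0 := by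
  have hne := fun k : rangeSupp e P => he.coord_map_basis_self_ne_zero hmono hP hP1 k.2
  have hne0 : ∀ k : rangeSupp e P, P (e k) ≠ 0 := fun k h => hne k (by rw [h, map_zero])
  refine hY.apply_eq_zero (he.isHermitianOp_compression hP hP1 i) (hne i)
    (he.isHermitianOp_compression hP hP1 j) (hne j) ?_
  rw [LinearIndependent.pair_iff' fun h => hne0 i (congrArg Subtype.val h)]
  intro a h
  have h' : a • P (e i) = P (e j) := congrArg Subtype.val h
  have ha : a ≠ 0 := by
    rintro rfl
    exact hne0 j (by rw [← h', zero_smul])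
  refine hij ?_
  rw [imageLine, imageLine, ← h', Submodule.span_singleton_smul_eq (IsUnit.mk0 a ha)]

end ContractiveProjection

/-! ### Indexing by dimension -/

section Indexing

theorem exists_equiv_of_countable (J : Type*) [Countable J] :
    Nonempty ({j : ℕ // (j : ℕ∞) < ENat.card J} ≃ J) := by
  rcases finite_or_infinite J with h | h
  · rw [ENat.card_eq_coe_natCard]
    exact ⟨(Equiv.subtypeEquivRight (by simp)).trans
      (Fin.equivSubtype.symm.trans (Finite.equivFin J).symm)⟩
  · rw [ENat.card_eq_top_of_infinite]
    obtain ⟨_⟩ := nonempty_denumerable J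
    exact ⟨(Equiv.subtypeUnivEquiv (by simp)).trans (Denumerable.eqv J).symm⟩

/-- A closed subspace that is the closed span of a linearly independent family has the cardinality
of the family as its dimension in `ℕ ∪ {∞}`. -/
theorem card_eq_dim_of_linearIndependent {X : Type*} [NormedAddCommGroup X] [NormedSpace ℂ X]
    {J : Type*} {v : J → X} (hv : LinearIndependent ℂ v) {Y : Submodule ℂ X}
    (hY : (Submodule.span ℂ (Set.range v)).topologicalClosure = Y) :
    ENat.card J = dim Y := by
  have hc : ENat.card J = ENat.card (Set.range v) :=
    ENat.card_congr (Equiv.ofInjective v hv.injective)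
  have hle := (Submodule.le_topologicalClosure (Submodule.span ℂ (Set.range v))).trans_eq hY
  have hr := Submodule.rank_mono hle
  rw [rank_span hv] at hr
  rcases finite_or_infinite J with h | h
  · have : FiniteDimensional ℂ (Submodule.span ℂ (Set.range v)) :=
      FiniteDimensional.span_of_finite ℂ (Set.finite_range v)
    rw [(Submodule.closed_of_finiteDimensional _).submodule_topologicalClosure_eq] at hY
    rw [hc, dim, ← hY, rank_span hv, ENat.card]
  · have : Infinite (Set.range v) := Set.infinite_coe_iff.2 (Set.infinite_range_of_injective
      hv.injective)
    rw [ENat.card_eq_top.2 h, dim, eq_comm, Cardinal.toENat_eq_top]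
    exact (Cardinal.aleph0_le_mk _).trans hr

end Indexing

/-! ### Decomposition of the range -/

section Decomposition

variable {ι X : Type*} [NormedAddCommGroup X] [NormedSpace ℂ X] [CompleteSpace X]
  {e : UnconditionalSchauderBasis ι ℂ X} {P : X →L[ℂ] X}

/-- Indices with the same image line `ℂ ∙ P (e r)` see elements of the range as multiples of
`P (e r)`. Indeed the functional `coord i (P (e r)) * coord r - coord r (P (e r)) * coord i` kills
`P (e j)` for all `j ∈ rangeSupp e P`, and only these `j` occur in the expansion of an element of
the range. -/
theorem IsOneUnconditional.coord_mul_coord_eq (he : IsOneUnconditional e)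
    (hmono : IsStrictlyMonotone e) (hP : IsIdempotentElem P) (hP1 : ‖P‖ = 1)
    (hY : NoNontrivialHilbertComponents P.toLinearMap.range) {i r : rangeSupp e P}
    (hir : imageLine e P i = imageLine e P r) {y : X} (hy : y ∈ P.toLinearMap.range) :
    e.coord i (P (e r)) * e.coord r y = e.coord r (P (e r)) * e.coord i y := by
  let ψ : StrongDual ℂ X := e.coord i (P (e r)) • e.coord r - e.coord r (P (e r)) • e.coord i
  suffices h : ψ y = 0 by simpa [ψ, sub_eq_zero] using h
  have hsum := (hasSum_coord_smul_map e P y).mapL ψ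
  rw [apply_eq_self_of_mem_range hP hy] at hsum
  suffices hzero : ∀ j, ψ (e.coord j y • P (e j)) = 0 by
    simp only [hzero] at hsum
    exact hsum.unique hasSum_zero
  intro j
  rw [map_smul]
  by_cases hj : j ∈ rangeSupp e P
  · by_cases hjr : imageLine e P r = imageLine e P ⟨j, hj⟩
    · have hmem : P (e j) ∈ imageLine e P r := hjr ▸ Submodule.mem_span_singleton_self _
      obtain ⟨a, ha⟩ := Submodule.mem_span_singleton.1 hmem
      rw [← ha]
      simp [ψ]; ring_nf; simp
    · have h1 := he.coord_map_basis_eq_zero hmono hP hP1 hY hjr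
      have h2 := he.coord_map_basis_eq_zero hmono hP hP1 hY (hir ▸ hjr : imageLine e P i ≠ _)
      simp only at h1 h2
      simp [ψ, h1, h2]
  · have : e.coord j y = 0 := by
      by_contra h
      exact hj ⟨y, hy, h⟩
    simp [this]

/-- The range decomposes along disjointly supported vectors, one on each image line. -/
theorem IsOneUnconditional.exists_disjoint_decomposition (he : IsOneUnconditional e)
    (hmono : IsStrictlyMonotone e) (hP : IsIdempotentElem P) (hP1 : ‖P‖ = 1)
    (hY : NoNontrivialHilbertComponents P.toLinearMap.range) :
    ∃ (y : Set.range (imageLine e P) → X) (y' : Set.range (imageLine e P) → StrongDual ℂ X),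
      (Pairwise fun j k => Disjoint (supp e (y j)) (supp e (y k))) ∧
      (∀ j, y j ∈ P.toLinearMap.range) ∧
      (∀ j, ‖y j‖ = 1 ∧ ‖y' j‖ = 1 ∧ y' j (y j) = 1) ∧
      ∀ x, HasSum (fun j => y' j x • y j) (P x) := by
  classical
  have hne := fun k : rangeSupp e P => he.coord_map_basis_self_ne_zero hmono hP hP1 k.2
  have hne0 : ∀ k : rangeSupp e P, P (e k) ≠ 0 := fun k h => hne k (by rw [h, map_zero])
  choose ρ hρ using fun c : Set.range (imageLine e P) => c.2
  set t : Set.range (imageLine e P) → ℂ := fun c => ((‖P (e (ρ c))‖⁻¹ : ℝ) : ℂ) with ht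
  have ht0 : ∀ c, t c ≠ 0 := fun c => by simpa [ht] using hne0 (ρ c)
  set y : Set.range (imageLine e P) → X := fun c => t c • P (e (ρ c)) with hy
  set y' : Set.range (imageLine e P) → StrongDual ℂ X := fun c =>
    (e.coord (ρ c) (y c))⁻¹ • (e.coord (ρ c) ∘L P) with hy'
  have hyY : ∀ c, y c ∈ P.toLinearMap.range := fun c => ⟨t c • e (ρ c), by simp [hy]⟩
  have hρy : ∀ c, e.coord (ρ c) (y c) ≠ 0 := fun c => by
    simpa [hy] using ⟨ht0 c, hne (ρ c)⟩
  have hnorm : ∀ c, ‖y c‖ = 1 := fun c => by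
    have : ‖P (e (ρ c))‖ ≠ 0 := norm_ne_zero_iff.2 (hne0 _)
    simp only [hy, ht, norm_smul, Complex.norm_real, norm_inv, norm_norm]
    exact inv_mul_cancel₀ this
  have hself : ∀ c, y' c (y c) = 1 := fun c => by
    simp only [hy', _root_.smul_apply, ContinuousLinearMap.comp_apply,
      apply_eq_self_of_mem_range hP (hyY c), smul_eq_mul]
    exact inv_mul_cancel₀ (hρy c)
  -- The support of `y c` consists of indices with image line `c`.
  have hsupp : ∀ c i, e.coord i (y c) ≠ 0 → ∃ hi : i ∈ rangeSupp e P,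
      imageLine e P ⟨i, hi⟩ = c := by
    intro c i hi
    have hiA : i ∈ rangeSupp e P := ⟨y c, hyY c, hi⟩
    refine ⟨hiA, ?_⟩
    by_contra hcon
    refine hi ?_
    have := he.coord_map_basis_eq_zero hmono hP hP1 hY (i := ⟨i, hiA⟩) (j := ρ c)
      (fun h => hcon (h.trans (hρ c)))
    simp only at this
    simp [hy, this]
  have hcoord : ∀ (c : Set.range (imageLine e P)) (i : rangeSupp e P), imageLine e P i = c → ∀ x,
      e.coord i (y' c x • y c) = e.coord i (P x) := by
    intro c i hi x
    have h := he.coord_mul_coord_eq hmono hP hP1 hY (i := i) (r := ρ c) (hi.trans (hρ c).symm)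
      (y := P x) ⟨x, rfl⟩
    have h1 := hne (ρ c)
    have h2 := ht0 c
    simp only [hy', hy, _root_.smul_apply, ContinuousLinearMap.comp_apply, map_smul,
      smul_eq_mul]
    field_simp
    linear_combination h
  -- Hence `y' c x • y c` is the band projection of `P x` to the indices with image line `c`.
  have hle : ∀ c x, ‖y' c x • y c‖ ≤ ‖x‖ := by
    intro c x
    obtain ⟨w, hw, hwc⟩ := he.exists_coord_eq_indicator
      {i | ∃ hi : i ∈ rangeSupp e P, imageLine e P ⟨i, hi⟩ = c} (P x)
    have : w = y' c x • y c := by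
      refine ext_coord e fun i => ?_
      rw [hwc]
      by_cases hi : ∃ hi : i ∈ rangeSupp e P, imageLine e P ⟨i, hi⟩ = c
      · rw [Set.indicator_of_mem (by exact hi)]
        exact (hcoord c ⟨i, hi.1⟩ hi.2 x).symm
      · have h0 : e.coord i (y c) = 0 := by
          by_contra h
          exact hi (hsupp c i h)
        rw [Set.indicator_of_notMem (by exact hi), map_smul, h0, smul_zero]
    rw [← this]
    exact hw.trans (by simpa [hP1] using P.le_opNorm x)
  refine ⟨y, y', fun c d hcd => ?_, hyY, fun c => ⟨hnorm c, ?_, hself c⟩, fun x => ?_⟩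
  · refine Set.disjoint_left.2 fun i hc hd => ?_
    obtain ⟨h1, h2⟩ := hsupp c i hc
    obtain ⟨h3, h4⟩ := hsupp d i hd
    exact hcd (Subtype.ext (h2.symm.trans h4))
  · refine le_antisymm ((y' c).opNorm_le_bound zero_le_one fun x => ?_) ?_
    · simpa [norm_smul, hnorm] using hle c x
    · simpa [hself, hnorm] using (y' c).le_opNorm (y c)
  · have h1 : HasSum (fun i : rangeSupp e P => e.coord i (P x) • e (i : ι)) (P x) := by
      refine (hasSum_subtype_iff_of_support_subset (f := fun i => e.coord i (P x) • e i) ?_).2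
        (e.expansion (P x))
      intro i hi
      exact ⟨P x, ⟨x, rfl⟩, fun h => hi (by simp [h])⟩
    convert h1.tsum_fiberwise (Set.rangeFactorization (imageLine e P)) using 2 with c
    have h2 : HasSum (fun i : rangeSupp e P => e.coord i (y' c x • y c) • e (i : ι))
        (y' c x • y c) := by
      refine (hasSum_subtype_iff_of_support_subset
        (f := fun i => e.coord i (y' c x • y c) • e i) ?_).2 (e.expansion _)
      intro i hi
      refine (hsupp c i fun h => hi ?_).1
      simp [h]
    have h3 := (hasSum_subtype_iff_of_support_subset
      (s := Set.rangeFactorization (imageLine e P) ⁻¹' {c}) fun i hi => ?_).2 h2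
    · rw [← h3.tsum_eq]
      refine tsum_congr fun i => ?_
      simp only [Function.comp_apply]
      rw [hcoord c i (congrArg Subtype.val i.2) x]
    · obtain ⟨_, h⟩ := hsupp c i fun h => hi (by simp [h])
      exact Subtype.ext h

end Decomposition

end OneComplemented

theorem corollary3p2 {ι X : Type*} [Countable ι]
    [NormedAddCommGroup X] [NormedSpace ℂ X] [CompleteSpace X]
    (e : UnconditionalSchauderBasis ι ℂ X)
    (he : OneComplemented.IsOneUnconditional e)
    (hmono : OneComplemented.IsStrictlyMonotone e)
    (P : X →L[ℂ] X) (hP : IsIdempotentElem P) (hP1 : ‖P‖ = 1)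
    (hY : OneComplemented.NoNontrivialHilbertComponents P.toLinearMap.range) :
    ∃ (y : {j : ℕ // (j : ℕ∞) < OneComplemented.dim P.toLinearMap.range} → X)
      (y' : {j : ℕ // (j : ℕ∞) < OneComplemented.dim P.toLinearMap.range} → StrongDual ℂ X),
      (Pairwise fun j k => Disjoint (OneComplemented.supp e (y j)) (OneComplemented.supp e (y k))) ∧
      (Submodule.span ℂ (Set.range y)).topologicalClosure = P.toLinearMap.range ∧
      (∀ j, ‖y j‖ = 1 ∧ ‖y' j‖ = 1 ∧ y' j (y j) = 1) ∧
      ∀ x, HasSum (fun j => y' j x • y j) (P x) := by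
  obtain ⟨y, y', hdisj, hmem, hnorm, hsum⟩ :=
    he.exists_disjoint_decomposition hmono hP hP1 hY
  have hspan : (Submodule.span ℂ (Set.range y)).topologicalClosure = P.toLinearMap.range := by
    apply le_antisymm
    · refine Submodule.topologicalClosure_minimal _ (Submodule.span_le.2 ?_)
        (ContinuousLinearMap.IsIdempotentElem.isClosed_range hP)
      rintro _ ⟨c, rfl⟩
      exact hmem c
    · rintro _ ⟨x, rfl⟩
      refine mem_closure_of_tendsto (hsum x) (Filter.Eventually.of_forall fun s => ?_)
      exact Submodule.sum_mem _ fun c _ => Submodule.smul_mem _ _ (Submodule.subset_span ⟨c, rfl⟩)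
  have hind : LinearIndependent ℂ y := by
    refine linearIndependent_iff'.2 fun s a hs c hc => ?_
    have hc0 : y c ≠ 0 := fun h => by simpa [h] using (hnorm c).1
    obtain ⟨i, hi⟩ : ∃ i, e.coord i (y c) ≠ 0 := by
      by_contra! h
      exact hc0 (OneComplemented.ext_coord e (by simpa using h))
    have h := congrArg (e.coord i) hs
    rw [map_sum, Finset.sum_eq_single c, map_smul, map_zero, smul_eq_mul, mul_eq_zero] at h
    · exact h.resolve_right hi
    · intro d _ hdc
      have : e.coord i (y d) = 0 := by
        by_contra h'
        exact Set.disjoint_left.1 (hdisj hdc) h' hi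
      rw [map_smul, this, smul_zero]
    · exact fun h => absurd hc h
  have : Countable (Set.range (OneComplemented.imageLine e P)) :=
    (Set.countable_range _).to_subtype
  obtain ⟨σ⟩ := OneComplemented.exists_equiv_of_countable
    (Set.range (OneComplemented.imageLine e P))
  rw [OneComplemented.card_eq_dim_of_linearIndependent hind hspan] at σ
  refine ⟨y ∘ σ, y' ∘ σ, fun j k hjk => hdisj (σ.injective.ne hjk), ?_, fun j => hnorm (σ j),
    fun x => σ.hasSum_iff.2 (hsum x)⟩
  rwa [σ.surjective.range_comp]
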